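/- **Setting.** Write $D(a,r)$ for the disk of center $a$ and radius $r$ in $\mathbb C$, and $\mathbb D=D(0,1)$. Let $(a_n)_{n\ge1}$ be points of $D(0,1/4)$ such that the terms of even index and the terms of odd index are both dense in that disk; let $(r_n)_{n\ge 1}$ be positive reals decreasing to $0$ with $r_n\le \frac1{10}$ and $\sum_{n\ge1} 2^{-n}|\log r_n|<\infty$; let $(m_n)_{n\ge1}$ be positive integers. Put $R_n=\prod_{k=1}^n r_k$, $M_n=\prod_{k=1}^n m_k$ (so $R_0=M_0=1$), $$\delta_0=\tfrac12,\qquad \delta_{n+1}=\frac{\delta_n^2\,r_{n+1}}{4m_{n+1}^2},\qquad \varepsilon_{n+1}=\frac{\delta_n^2}{2m_{n+1}^2},$$ and $A_n(z,w)=z-a_n$ for $n$ odd, $A_n(z,w)=z+\frac{w}{100}-a_n$ for $n$ even. Let $\mathcal S_0$ be a one-point set, $P_{0,s}(z,w)=w$, and inductively $$\Sigma_{n+1}=\overline D\Big(0,\delta_n\big(1-\tfrac1{m_{n+1}}\big)\Big)\cap \tfrac{3\delta_n}{m_{n+1}}\mathbb Z[i],\qquad \mathcal S_{n+1}=\mathcal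 S_n\times\Sigma_{n+1},$$ $$P_{n+1,(s,\sigma)}=(P_{n,s}-\sigma)^2-\varepsilon_{n+1}A_{n+1}.$$ Fix a vertical slice near the boundary, that is, a line $\{z+\gamma w=z_0\}$ with $\gamma, z_0\in\mathbb C$, $|\gamma|\le\frac1{100}$, such that $\frac38<|z_0-\gamma w|<\frac12$ for all $w\in\mathbb D$ (for instance, any $z_0$ with $\frac38+\frac1{100}\le|z_0|\le\frac12-\frac1{100}$). Use $w$ as coordinate on the slice, write $P_{n,s}(w)$ for $P_{n,s}(z_0-\gamma w,w)$ and $P_{n,s}'$ for its derivative in $w$, and let $X_{n,s}=\{w\in\mathbb D:\ |P_{n,s}(w)|<\delta_n\}$ be the trace on the slice of $\{|P_{n,s}|<\delta_n\}\subset D(0,\frac12)\times\mathbb D$. A univalent map is an injective holomorphic map; the distortion of a univalent map $f$ on $\Delta$ is $\sup_{w,w'\in\Delta}|f'(w)/f'(w')|$; and $\Delta$ has conformal radius $\rho$ seen from $p\in\Delta$ if there is a univalent map $f$ from $\Delta$ onto $\mathbb D$ with $f(p)=0$ and $|f'(p)|=1/\rho$. **Proposition.** There are universal constants $K,C>0$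 (independent of the sequences $(a_n),(r_n),(m_n)$, of the slice, and of $n$, $s$, $\Delta$) such that the following holds for every $n\ge 0$, every $s\in\mathcal S_n$ and every connected component $\Delta$ of $X_{n,s}$. Put $C_n=C^{n}$ if $n\ge1$ and $C_0=C$. 1. $\Delta$ is, up to uniformly bounded distortion, a disk of conformal radius comparable to $R_n/M_n$: there is $p\in\Delta$ with $P_{n,s}(p)=0$ such that the conformal radius $\rho$ of $\Delta$ seen from $p$ exists and satisfies $$C_n^{-1}\,\frac{R_n}{M_n}\le\rho\le C_n\,\frac{R_n}{M_n},$$ and there is a univalent map $f$ from $\Delta$ onto $D(0,\rho)$ with $f(p)=0$, $|f'(p)|=1$ and distortion at most $K$. 2. $P_{n,s}$ is a univalent map from $\Delta$ onto $D(0,\delta_n)$ of distortion at most $K$, and for every $w\in\Delta$ $$C_n^{-1}\,\delta_n\frac{M_n}{R_n}\le|P_{n,s}'(w)|\le C_n\,\delta_n\frac{M_n}{R_n}.$$ -/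

import Mathlib

open Set Filter Topology Metric

open scoped ENNReal

noncomputable section

namespace Wermer

/-- The free parameters of the construction: the points `a n`, the ramification parameters `r n`
and the subdivision parameters `m n`. All sequences are indexed by `n ≥ 1`; the values at `n = 0`
are never used. -/
structure Param where
  a : ℕ → ℂ
  r : ℕ → ℝ
  m : ℕ → ℕ
  a_mem : ∀ n, 1 ≤ n → a n ∈ ball (0 : ℂ) (1 / 4)
  even_dense : ball (0 : ℂ) (1 / 4) ⊆ closure (a '' {n | 1 ≤ n ∧ Even n})
  odd_dense : ball (0 : ℂ) (1 / 4) ⊆ closure (a '' {n | 1 ≤ n ∧ Odd n})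
  r_pos : ∀ n, 1 ≤ n → 0 < r n
  r_le : ∀ n, 1 ≤ n → r n ≤ 1 / 10
  r_anti : ∀ n, 1 ≤ n → r (n + 1) ≤ r n
  r_lim : Tendsto r atTop (𝓝 0)
  r_summable : Summable fun n : ℕ => |Real.log (r n)| / 2 ^ n
  m_pos : ∀ n, 1 ≤ n → 1 ≤ m n

namespace Param

variable (W : Param)

/-- `δ 0 = 1 / 2` and `δ (n + 1) = δ n ^ 2 * r (n + 1) / (4 * m (n + 1) ^ 2)`. -/
def delta : ℕ → ℝ
  | 0 => 1 / 2
  | n + 1 => delta n ^ 2 * W.r (n + 1) / (4 * (W.m (n + 1) : ℝ) ^ 2)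

/-- `ε (n + 1) = δ n ^ 2 / (2 * m (n + 1) ^ 2)`; the value `ε 0` is never used. -/
def eps : ℕ → ℝ
  | 0 => 0
  | n + 1 => W.delta n ^ 2 / (2 * (W.m (n + 1) : ℝ) ^ 2)

/-- The affine functions `A n`, for `n ≥ 1`. -/
def A (n : ℕ) (z w : ℂ) : ℂ :=
  if Odd n then z - W.a n else z + w / 100 - W.a n

/-- `centers n` is the set `Σ_{n+1}` of centers used to subdivide the disk of radius `δ n`:
the points of the lattice `(3 δ n / m (n + 1)) ℤ[i]` that lie in the closed disk of center `0` and
radius `δ n * (1 - 1 / m (n + 1))`. -/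
def centers (n : ℕ) : Set ℂ :=
  closedBall (0 : ℂ) (W.delta n * (1 - 1 / (W.m (n + 1) : ℝ))) ∩
    {σ | ∃ i j : ℤ, σ = ((3 * W.delta n / (W.m (n + 1) : ℝ) : ℝ) : ℂ) *
      ((i : ℂ) + (j : ℂ) * Complex.I)}

/-- The index sets: `S 0` is a singleton and `S (n + 1) = S n × Σ_{n+1}`. -/
def S : ℕ → Type
  | 0 => Unit
  | n + 1 => S n × W.centers n

/-- The polynomials `P_{n,s}`: `P_0 (z, w) = w` and
`P_{n+1,(s,σ)} = (P_{n,s} - σ) ^ 2 - ε_{n+1} A_{n+1}`. -/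
def P : (n : ℕ) → W.S n → ℂ → ℂ → ℂ
  | 0, _, _, w => w
  | n + 1, (s, σ), z, w => (P n s z w - (σ : ℂ)) ^ 2 - (W.eps (n + 1) : ℂ) * W.A (n + 1) z w

/-- `X_{n,s} = {|P_{n,s}| < δ n}` in the bidisk `D(0, 1/2) × D(0, 1)`. -/
def X (n : ℕ) (s : W.S n) : Set (ℂ × ℂ) :=
  {p | p ∈ ball (0 : ℂ) (1 / 2) ×ˢ ball (0 : ℂ) 1 ∧ ‖W.P n s p.1 p.2‖ < W.delta n}

/-- The restriction of `P_{n,s}` to the line `z + γ w = z₀`, in the coordinate `w`. -/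
def sliceP (γ z₀ : ℂ) (n : ℕ) (s : W.S n) (w : ℂ) : ℂ :=
  W.P n s (z₀ - γ * w) w

/-- The trace of `X_{n,s}` on the line `z + γ w = z₀`, in the coordinate `w`. -/
def sliceX (γ z₀ : ℂ) (n : ℕ) (s : W.S n) : Set ℂ :=
  {w | (z₀ - γ * w, w) ∈ W.X n s}

/-- `R_n = r_1 ⋯ r_n`. -/
def R (n : ℕ) : ℝ := ∏ k ∈ Finset.Icc 1 n, W.r k

/-- `M_n = m_1 ⋯ m_n`. -/
def M (n : ℕ) : ℝ := ∏ k ∈ Finset.Icc 1 n, (W.m k : ℝ)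

end Param

/-- The line `z + γ w = z₀` is a vertical slice near the boundary: it is almost vertical, and over
the unit disk it is a graph with values in `{3/8 < |z| < 1/2}`. -/
def IsVerticalSlice (γ z₀ : ℂ) : Prop :=
  ‖γ‖ ≤ 1 / 100 ∧ ∀ w ∈ ball (0 : ℂ) 1, 3 / 8 < ‖z₀ - γ * w‖ ∧ ‖z₀ - γ * w‖ < 1 / 2

/-- A sufficient explicit condition, satisfied in particular when `‖z₀‖ = 2 / 5`. -/
theorem isVerticalSlice_of_norm {γ z₀ : ℂ} (hγ : ‖γ‖ ≤ 1 / 100)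
    (h₁ : 3 / 8 + 1 / 100 ≤ ‖z₀‖) (h₂ : ‖z₀‖ ≤ 1 / 2 - 1 / 100) : IsVerticalSlice γ z₀ := by
  refine ⟨hγ, fun w hw => ?_⟩
  have hw1 : ‖w‖ < 1 := by simpa using hw
  have h : ‖γ * w‖ < 1 / 100 := by
    rw [norm_mul]
    nlinarith [norm_nonneg γ, norm_nonneg w]
  have h3 := norm_sub_norm_le z₀ (γ * w)
  have h4 := norm_sub_le z₀ (γ * w)
  constructor <;> linarith

/-- `Δ` is a connected component of `U`. -/
def IsComponent (Δ U : Set ℂ) : Prop :=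
  ∃ x ∈ U, Δ = connectedComponentIn U x

/-- `f` is a univalent (holomorphic and injective) map from `U` onto `V`. -/
def IsUnivalentOnto (f : ℂ → ℂ) (U V : Set ℂ) : Prop :=
  DifferentiableOn ℂ f U ∧ BijOn f U V

/-- The distortion `sup_{z, w ∈ U} |f'(z) / f'(w)|`. -/
def distortion (f : ℂ → ℂ) (U : Set ℂ) : ℝ≥0∞ :=
  ⨆ z ∈ U, ⨆ w ∈ U, ‖deriv f z‖ₑ / ‖deriv f w‖ₑ

/-- The topological disk `Δ` has conformal radius `ρ`, seen from the point `p`: there is a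
conformal map `f` from `Δ` onto the unit disk with `f p = 0` and `|f'(p)| = 1 / ρ`. -/
def HasConformalRadius (Δ : Set ℂ) (p : ℂ) (ρ : ℝ) : Prop :=
  0 < ρ ∧ p ∈ Δ ∧ ∃ f : ℂ → ℂ, IsUnivalentOnto f Δ (ball 0 1) ∧ f p = 0 ∧ ‖deriv f p‖ = 1 / ρ

/-- `x ≈ y` at rank `n` with constant `C`: for `n ≥ 1` this reads `x / C ^ n ≤ y ≤ C ^ n * x`;
for `n = 0` the factor is `C` instead of `C ^ 0`. -/
def Approx (C : ℝ) (n : ℕ) (x y : ℝ) : Prop :=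
  x / C ^ max n 1 ≤ y ∧ y ≤ C ^ max n 1 * x

end Wermer

end

/-! On the slice, `A n` equals `z₀ - a n` plus a term of slope at most 1/50, and `‖z₀ - a n‖ ≥ 1/8`:
the slice stays away from the ramification. With `mesh n = δ n / m (n+1)`, membership in `X_{n+1}`
forces `(P_n - σ)²` close to the nonzero constant `ε (z₀ - a)`, hence `‖P_n - σ‖` comparable to
`mesh n`, with universal constants.

Differentiating the recursion then multiplies `‖P_n'‖` by a factor comparable to `mesh n`
(`norm_sliceD_succ_bounds`). Since `δ M / R` is multiplied by exactly `mesh n / 4`, the derivative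
bounds follow with a geometric loss. The distortion bound loses nothing: the inequality `δ |P''| ≤
|P'|²` propagates with constant 1 (`delta_mul_norm_sliceDD_le`), and along the inverse branch it
bounds the logarithmic derivative of `P'` by `1/δ` on a disk of diameter `2δ`, whence the distortion
`exp 2`.

Injectivity holds because `P_n - σ` follows a single branch of the square root on a connected set
(`mesh_le_norm_add_sub_centers`). Surjectivity is an open-closed argument (`surjOn_sliceP`). The
uniformizing maps are multiples of `P_n`. -/

namespace Wermer

namespace Param

variable (W : Param)

/-! ### Restrictions to the slice and their derivatives in `w`. -/

/-- The derivative in `w` of `A n` along the slice. -/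
noncomputable def sliceSlope (γ : ℂ) (n : ℕ) : ℂ :=
  if Odd n then -γ else 1 / 100 - γ

/-- The first derivative of `sliceP`. -/
noncomputable def sliceD (γ z₀ : ℂ) : (n : ℕ) → W.S n → ℂ → ℂ
  | 0, _, _ => 1
  | n + 1, (s, σ), w => 2 * (W.sliceP γ z₀ n s w - (σ : ℂ)) * sliceD γ z₀ n s w -
      (W.eps (n + 1) : ℂ) * sliceSlope γ (n + 1)

/-- The second derivative of `sliceP`. -/
noncomputable def sliceDD (γ z₀ : ℂ) : (n : ℕ) → W.S n → ℂ → ℂ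
  | 0, _, _ => 0
  | n + 1, (s, σ), w => 2 * W.sliceD γ z₀ n s w ^ 2 +
      2 * (W.sliceP γ z₀ n s w - (σ : ℂ)) * sliceDD γ z₀ n s w

theorem A_slice (γ z₀ : ℂ) (n : ℕ) (w : ℂ) :
    W.A n (z₀ - γ * w) w = (z₀ - W.a n) + sliceSlope γ n * w := by
  unfold A sliceSlope
  split_ifs <;> ring

theorem sliceP_zero (γ z₀ : ℂ) (s : W.S 0) (w : ℂ) : W.sliceP γ z₀ 0 s w = w := rfl

theorem sliceP_succ (γ z₀ : ℂ) (n : ℕ) (s : W.S n) (σ : W.centers n) (w : ℂ) :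
    W.sliceP γ z₀ (n + 1) (s, σ) w = (W.sliceP γ z₀ n s w - (σ : ℂ)) ^ 2 -
      (W.eps (n + 1) : ℂ) * ((z₀ - W.a (n + 1)) + sliceSlope γ (n + 1) * w) := by
  rw [← A_slice]; rfl

theorem hasDerivAt_sliceP (γ z₀ : ℂ) (n : ℕ) (s : W.S n) (w : ℂ) :
    HasDerivAt (W.sliceP γ z₀ n s) (W.sliceD γ z₀ n s w) w := by
  induction n with
  | zero => exact hasDerivAt_id w
  | succ n ih =>
    obtain ⟨s, σ⟩ := s
    have e : W.sliceP γ z₀ (n + 1) (s, σ) = fun w => (W.sliceP γ z₀ n s w - (σ : ℂ)) ^ 2 -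
        (W.eps (n + 1) : ℂ) * ((z₀ - W.a (n + 1)) + sliceSlope γ (n + 1) * w) :=
      funext (W.sliceP_succ γ z₀ n s σ)
    rw [e]
    have h := (((ih s).sub_const (σ : ℂ)).pow 2).sub
      ((((hasDerivAt_id w).const_mul (sliceSlope γ (n + 1))).const_add
        (z₀ - W.a (n + 1))).const_mul (W.eps (n + 1) : ℂ))
    refine h.congr_deriv ?_
    simp only [sliceD]
    push_cast
    ring

theorem hasDerivAt_sliceD (γ z₀ : ℂ) (n : ℕ) (s : W.S n) (w : ℂ) :
    HasDerivAt (W.sliceD γ z₀ n s) (W.sliceDD γ z₀ n s w) w := by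
  induction n with
  | zero => exact hasDerivAt_const w 1
  | succ n ih =>
    obtain ⟨s, σ⟩ := s
    have h := (((((W.hasDerivAt_sliceP γ z₀ n s w).sub_const (σ : ℂ)).const_mul 2).mul
      (ih s)).sub_const ((W.eps (n + 1) : ℂ) * sliceSlope γ (n + 1)))
    refine h.congr_deriv ?_
    simp only [sliceDD]
    ring

theorem continuous_sliceP (γ z₀ : ℂ) (n : ℕ) (s : W.S n) : Continuous (W.sliceP γ z₀ n s) :=
  continuous_iff_continuousAt.2 fun w => (W.hasDerivAt_sliceP γ z₀ n s w).continuousAt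

theorem delta_pos (n : ℕ) : 0 < W.delta n := by
  induction n with
  | zero => norm_num [delta]
  | succ n ih =>
    have h1 := W.r_pos (n + 1) (by omega)
    have h2 : (0 : ℝ) < W.m (n + 1) := by exact_mod_cast W.m_pos (n + 1) (by omega)
    simp only [delta]
    positivity

theorem R_pos (n : ℕ) : 0 < W.R n :=
  Finset.prod_pos fun k hk => W.r_pos k (Finset.mem_Icc.1 hk).1

theorem M_pos (n : ℕ) : 0 < W.M n :=
  Finset.prod_pos fun k hk => by exact_mod_cast W.m_pos k (Finset.mem_Icc.1 hk).1

theorem R_succ (n : ℕ) : W.R (n + 1) = W.R n * W.r (n + 1) :=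
  Finset.prod_Icc_succ_top (by omega) _

theorem M_succ (n : ℕ) : W.M (n + 1) = W.M n * W.m (n + 1) :=
  Finset.prod_Icc_succ_top (by omega) _

variable {γ z₀ : ℂ}

/-! ### Size estimates for one step of the recursion. -/

theorem mem_sliceX_iff (h : IsVerticalSlice γ z₀) {n : ℕ} {s : W.S n} {w : ℂ} :
    w ∈ W.sliceX γ z₀ n s ↔ ‖w‖ < 1 ∧ ‖W.sliceP γ z₀ n s w‖ < W.delta n := by
  simp only [sliceX, X, sliceP, mem_ofPred_eq, mem_prod, mem_ball_zero_iff]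
  constructor
  · exact fun H => ⟨H.1.2, H.2⟩
  · exact fun H => ⟨⟨(h.2 w (by simpa using H.1)).2, H.1⟩, H.2⟩

theorem norm_sliceSlope_le (h : IsVerticalSlice γ z₀) (n : ℕ) : ‖sliceSlope γ n‖ ≤ 1 / 50 := by
  have h1 := h.1
  unfold sliceSlope
  split_ifs
  · rw [norm_neg]; linarith
  · refine (norm_sub_le _ _).trans ?_
    have : ‖(1 / 100 : ℂ)‖ = 1 / 100 := by norm_num
    linarith

theorem norm_sub_a_bounds (h : IsVerticalSlice γ z₀) {n : ℕ} (hn : 1 ≤ n) :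
    1 / 8 ≤ ‖z₀ - W.a n‖ ∧ ‖z₀ - W.a n‖ ≤ 3 / 4 := by
  have h0 := h.2 0 (by simp)
  simp only [mul_zero, sub_zero] at h0
  have ha : ‖W.a n‖ < 1 / 4 := by simpa using W.a_mem n hn
  have h3 := norm_sub_norm_le z₀ (W.a n)
  have h4 := norm_sub_le z₀ (W.a n)
  constructor <;> linarith

/-- The scale `δ n / m (n + 1)` of the subdivision at rank `n`. -/
noncomputable def mesh (n : ℕ) : ℝ := W.delta n / W.m (n + 1)

theorem mesh_pos (n : ℕ) : 0 < W.mesh n :=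
  div_pos (W.delta_pos n) (by exact_mod_cast W.m_pos (n + 1) (by omega))

theorem mesh_le (n : ℕ) : W.mesh n ≤ W.delta n :=
  div_le_self (W.delta_pos n).le (by exact_mod_cast W.m_pos (n + 1) (by omega))

theorem eps_succ (n : ℕ) : W.eps (n + 1) = W.mesh n ^ 2 / 2 := by
  simp only [eps, mesh]; ring

theorem delta_succ (n : ℕ) : W.delta (n + 1) = W.mesh n ^ 2 * W.r (n + 1) / 4 := by
  simp only [delta, mesh]; ring

theorem delta_succ_le (n : ℕ) : W.delta (n + 1) ≤ W.mesh n ^ 2 / 40 := by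
  have := W.r_le (n + 1) (by omega)
  rw [delta_succ]
  nlinarith [sq_nonneg (W.mesh n)]

theorem norm_center_le (n : ℕ) (σ : W.centers n) : ‖(σ : ℂ)‖ ≤ W.delta n - W.mesh n := by
  have h := σ.2.1
  rw [mem_closedBall_zero_iff] at h
  refine h.trans_eq ?_
  simp only [mesh]; ring

theorem sq_sub_center (n : ℕ) (s : W.S n) (σ : W.centers n) (w : ℂ) :
    (W.sliceP γ z₀ n s w - (σ : ℂ)) ^ 2 = W.sliceP γ z₀ (n + 1) (s, σ) w +
      (W.eps (n + 1) : ℂ) * (z₀ - W.a (n + 1)) +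
      (W.eps (n + 1) : ℂ) * (sliceSlope γ (n + 1) * w) := by
  rw [sliceP_succ]; ring

theorem norm_eps_slope_le (h : IsVerticalSlice γ z₀) (n : ℕ) :
    ‖(W.eps (n + 1) : ℂ) * sliceSlope γ (n + 1)‖ ≤ W.mesh n ^ 2 / 100 := by
  have h1 := norm_sliceSlope_le h (n + 1)
  rw [norm_mul, Complex.norm_real, eps_succ, Real.norm_of_nonneg (by positivity)]
  nlinarith [sq_nonneg (W.mesh n)]

theorem norm_eps_slope_mul_le (h : IsVerticalSlice γ z₀) (n : ℕ) {w : ℂ} (hw : ‖w‖ < 1) :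
    ‖(W.eps (n + 1) : ℂ) * (sliceSlope γ (n + 1) * w)‖ ≤ W.mesh n ^ 2 / 100 := by
  rw [← mul_assoc, norm_mul]
  exact (mul_le_of_le_one_right (norm_nonneg _) hw.le).trans (W.norm_eps_slope_le h n)

theorem norm_eps_mul_bounds (h : IsVerticalSlice γ z₀) (n : ℕ) :
    W.mesh n ^ 2 / 16 ≤ ‖(W.eps (n + 1) : ℂ) * (z₀ - W.a (n + 1))‖ ∧
      ‖(W.eps (n + 1) : ℂ) * (z₀ - W.a (n + 1))‖ ≤ W.mesh n ^ 2 * (3 / 8) := by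
  obtain ⟨h1, h2⟩ := W.norm_sub_a_bounds h (n := n + 1) (by omega)
  rw [norm_mul, Complex.norm_real, eps_succ, Real.norm_of_nonneg (by positivity)]
  constructor <;> nlinarith [sq_nonneg (W.mesh n)]

/-- In `sq_sub_center` the main term has size between 1/16 and 3/8 in units of `mesh n ^ 2`, and the
two others at most 1/40 and 1/100. Hence 41/100 and 11/400 for the square; then take roots. -/
theorem norm_sub_center_bounds (h : IsVerticalSlice γ z₀) {n : ℕ} {s : W.S n} {σ : W.centers n}
    {w : ℂ} (hw : w ∈ W.sliceX γ z₀ (n + 1) (s, σ)) :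
    33 / 200 * W.mesh n ≤ ‖W.sliceP γ z₀ n s w - σ‖ ∧
      ‖W.sliceP γ z₀ n s w - σ‖ ≤ 13 / 20 * W.mesh n := by
  replace hw := (W.mem_sliceX_iff h).1 hw
  obtain ⟨h1, h2⟩ := W.norm_eps_mul_bounds h n
  have h3 := W.norm_eps_slope_mul_le h n hw.1
  have h4 := hw.2.le.trans (W.delta_succ_le n)
  have e := W.sq_sub_center (γ := γ) (z₀ := z₀) n s σ w
  have hd := W.mesh_pos n
  have e1 : ‖W.sliceP γ z₀ n s w - σ‖ ^ 2 ≤ W.mesh n ^ 2 * (41 / 100) := by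
    rw [← norm_pow, e]
    refine (norm_add₃_le).trans ?_
    linarith
  have e2 : W.mesh n ^ 2 * (11 / 400) ≤ ‖W.sliceP γ z₀ n s w - σ‖ ^ 2 := by
    rw [← norm_pow]
    have : (W.eps (n + 1) : ℂ) * (z₀ - W.a (n + 1)) = (W.sliceP γ z₀ n s w - (σ : ℂ)) ^ 2 -
      W.sliceP γ z₀ (n + 1) (s, σ) w - (W.eps (n + 1) : ℂ) * (sliceSlope γ (n + 1) * w) := by
      rw [e]; ring
    rw [this] at h1
    have h5 := norm_sub_le ((W.sliceP γ z₀ n s w - (σ : ℂ)) ^ 2 -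
      W.sliceP γ z₀ (n + 1) (s, σ) w) ((W.eps (n + 1) : ℂ) * (sliceSlope γ (n + 1) * w))
    have h6 := norm_sub_le ((W.sliceP γ z₀ n s w - (σ : ℂ)) ^ 2)
      (W.sliceP γ z₀ (n + 1) (s, σ) w)
    linarith
  constructor
  · refine le_of_sq_le_sq ?_ (norm_nonneg _)
    nlinarith [sq_nonneg (W.mesh n)]
  · refine le_of_sq_le_sq ?_ (by positivity)
    nlinarith [sq_nonneg (W.mesh n)]

theorem sliceX_succ_subset (h : IsVerticalSlice γ z₀) (n : ℕ) (s : W.S n) (σ : W.centers n) :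
    W.sliceX γ z₀ (n + 1) (s, σ) ⊆ W.sliceX γ z₀ n s := by
  intro w hw
  have h1 := (W.norm_sub_center_bounds h hw).2
  refine (W.mem_sliceX_iff h).2 ⟨((W.mem_sliceX_iff h).1 hw).1, ?_⟩
  have h2 := W.norm_center_le n σ
  have h3 := norm_add_le (W.sliceP γ z₀ n s w - σ) (σ : ℂ)
  rw [sub_add_cancel] at h3
  linarith [W.mesh_pos n]

/-- The traces are nested and `δ 0 = 1/2`. This keeps components away from `‖w‖ = 1`, as needed for
surjectivity. -/
theorem norm_lt_half_of_mem_sliceX (h : IsVerticalSlice γ z₀) (n : ℕ) (s : W.S n) {w : ℂ}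
    (hw : w ∈ W.sliceX γ z₀ n s) : ‖w‖ < 1 / 2 := by
  induction n with
  | zero => exact ((W.mem_sliceX_iff h).1 hw).2
  | succ n ih =>
    obtain ⟨s, σ⟩ := s
    exact ih s (W.sliceX_succ_subset h n s σ hw)

/-! ### First and second derivatives. -/

theorem two_mul_delta_succ_le (n : ℕ) :
    2 * W.delta (n + 1) ≤ 65 / 100 * W.mesh n * W.delta n := by
  have h1 := W.delta_succ_le n
  have h2 := W.mesh_pos n
  have h3 := W.mesh_le n
  nlinarith

/-- The assumption `hD` lets the slope term, at most `mesh n ^ 2 / 100`, be absorbed at the cost of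
1/200 in the factor `2 ‖P_n - σ‖ / mesh n`, which lies between 0.33 and 1.3. -/
theorem norm_sliceD_succ_bounds (h : IsVerticalSlice γ z₀) {n : ℕ} {s : W.S n} {σ : W.centers n}
    {w : ℂ} (hw : w ∈ W.sliceX γ z₀ (n + 1) (s, σ))
    (hD : 2 * W.delta n ≤ ‖W.sliceD γ z₀ n s w‖) :
    325 / 1000 * W.mesh n * ‖W.sliceD γ z₀ n s w‖ ≤ ‖W.sliceD γ z₀ (n + 1) (s, σ) w‖ ∧
      ‖W.sliceD γ z₀ (n + 1) (s, σ) w‖ ≤ 1305 / 1000 * W.mesh n * ‖W.sliceD γ z₀ n s w‖ := by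
  obtain ⟨h1, h2⟩ := W.norm_sub_center_bounds h hw
  have h3 := W.norm_eps_slope_le h n
  have h4 : W.mesh n ^ 2 / 100 ≤ 1 / 200 * W.mesh n * ‖W.sliceD γ z₀ n s w‖ := by
    nlinarith [W.mesh_pos n, W.mesh_le n]
  have e : ‖2 * (W.sliceP γ z₀ n s w - (σ : ℂ)) * W.sliceD γ z₀ n s w‖ =
      2 * ‖W.sliceP γ z₀ n s w - (σ : ℂ)‖ * ‖W.sliceD γ z₀ n s w‖ := by
    simp
  have h5 := norm_sub_le (2 * (W.sliceP γ z₀ n s w - (σ : ℂ)) * W.sliceD γ z₀ n s w)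
    ((W.eps (n + 1) : ℂ) * sliceSlope γ (n + 1))
  have h6 := norm_sub_norm_le (2 * (W.sliceP γ z₀ n s w - (σ : ℂ)) * W.sliceD γ z₀ n s w)
    ((W.eps (n + 1) : ℂ) * sliceSlope γ (n + 1))
  have h7 := mul_le_mul_of_nonneg_right h1 (norm_nonneg (W.sliceD γ z₀ n s w))
  have h8 := mul_le_mul_of_nonneg_right h2 (norm_nonneg (W.sliceD γ z₀ n s w))
  simp only [sliceD]
  constructor <;> linarith

theorem two_mul_delta_le_norm_sliceD (h : IsVerticalSlice γ z₀) (n : ℕ) (s : W.S n) {w : ℂ}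
    (hw : w ∈ W.sliceX γ z₀ n s) : 2 * W.delta n ≤ ‖W.sliceD γ z₀ n s w‖ := by
  induction n with
  | zero => simp [sliceD, delta]
  | succ n ih =>
    obtain ⟨s, σ⟩ := s
    have h1 := ih s (W.sliceX_succ_subset h n s σ hw)
    refine le_trans ?_ (W.norm_sliceD_succ_bounds h hw h1).1
    have := W.two_mul_delta_succ_le n
    nlinarith [mul_pos (W.mesh_pos n) (W.delta_pos n), mul_le_mul_of_nonneg_left h1 (W.mesh_pos n).le]

theorem sliceD_ne_zero (h : IsVerticalSlice γ z₀) (n : ℕ) (s : W.S n) {w : ℂ}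
    (hw : w ∈ W.sliceX γ z₀ n s) : W.sliceD γ z₀ n s w ≠ 0 := by
  have h1 := W.two_mul_delta_le_norm_sliceD h n s hw
  exact norm_pos_iff.1 (lt_of_lt_of_le (mul_pos two_pos (W.delta_pos n)) h1)

theorem delta_mul_M_div_R_succ (n : ℕ) :
    W.delta (n + 1) * W.M (n + 1) / W.R (n + 1) =
      W.mesh n / 4 * (W.delta n * W.M n / W.R n) := by
  have h1 := (W.r_pos (n + 1) (by omega)).ne'
  have h2 : (W.m (n + 1) : ℝ) ≠ 0 := by
    exact_mod_cast Nat.one_le_iff_ne_zero.1 (W.m_pos (n + 1) (by omega))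
  have h3 := (W.R_pos n).ne'
  rw [R_succ, M_succ, delta_succ, mesh]
  field_simp

theorem norm_sliceD_bounds (h : IsVerticalSlice γ z₀) (n : ℕ) (s : W.S n) {w : ℂ}
    (hw : w ∈ W.sliceX γ z₀ n s) :
    W.delta n * W.M n / W.R n ≤ ‖W.sliceD γ z₀ n s w‖ ∧
      ‖W.sliceD γ z₀ n s w‖ ≤ 2 * 6 ^ n * (W.delta n * W.M n / W.R n) := by
  induction n with
  | zero => norm_num [sliceD, delta, M, R]
  | succ n ih =>
    obtain ⟨s, σ⟩ := s
    have hw' := W.sliceX_succ_subset h n s σ hw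
    obtain ⟨h1, h2⟩ := ih s hw'
    obtain ⟨h3, h4⟩ := W.norm_sliceD_succ_bounds h hw (W.two_mul_delta_le_norm_sliceD h n s hw')
    have hd := W.mesh_pos n
    rw [delta_mul_M_div_R_succ]
    have h5 := mul_le_mul_of_nonneg_left h1 hd.le
    have h6 := mul_le_mul_of_nonneg_left h2 hd.le
    have h7 : 0 ≤ W.mesh n * ‖W.sliceD γ z₀ n s w‖ := by positivity
    constructor
    -- The factors 0.325 and 1.305 lie between 1/4 and 6/4.
    · linarith
    · rw [pow_succ]
      linarith

/-- The constant 1 survives the induction: `‖P''‖` is at most `3.3 ‖P_n'‖²`, and `δ (n+1) ≤ mesh n ^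
2 / 40` makes the product smaller than the square of the lower bound for the new derivative. -/
theorem delta_mul_norm_sliceDD_le (h : IsVerticalSlice γ z₀) (n : ℕ) (s : W.S n) {w : ℂ}
    (hw : w ∈ W.sliceX γ z₀ n s) :
    W.delta n * ‖W.sliceDD γ z₀ n s w‖ ≤ ‖W.sliceD γ z₀ n s w‖ ^ 2 := by
  induction n with
  | zero => simp [sliceD, sliceDD]
  | succ n ih =>
    obtain ⟨s, σ⟩ := s
    have hw' := W.sliceX_succ_subset h n s σ hw
    have h1 := ih s hw'
    have h3 := (W.norm_sliceD_succ_bounds h hw (W.two_mul_delta_le_norm_sliceD h n s hw')).1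
    have h2 := (W.norm_sub_center_bounds h hw).2
    have hd := W.mesh_pos n
    have h4 : ‖W.sliceDD γ z₀ (n + 1) (s, σ) w‖ ≤ 2 * ‖W.sliceD γ z₀ n s w‖ ^ 2 +
        2 * ‖W.sliceP γ z₀ n s w - (σ : ℂ)‖ * ‖W.sliceDD γ z₀ n s w‖ := by
      simp only [sliceDD]
      refine (norm_add_le _ _).trans_eq ?_
      simp
    set x := ‖W.sliceD γ z₀ n s w‖
    set y := ‖W.sliceDD γ z₀ n s w‖
    have hy : 0 ≤ y := norm_nonneg _
    have h5 : W.mesh n * y ≤ x ^ 2 := (mul_le_mul_of_nonneg_right (W.mesh_le n) hy).trans h1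
    have h6 : ‖W.sliceDD γ z₀ (n + 1) (s, σ) w‖ ≤ 33 / 10 * x ^ 2 := by
      have := mul_le_mul_of_nonneg_right h2 hy
      linarith
    calc W.delta (n + 1) * ‖W.sliceDD γ z₀ (n + 1) (s, σ) w‖
        ≤ W.mesh n ^ 2 / 40 * (33 / 10 * x ^ 2) :=
          mul_le_mul (W.delta_succ_le n) h6 (norm_nonneg _) (by positivity)
      _ ≤ (325 / 1000 * W.mesh n * x) ^ 2 := by
          nlinarith [mul_nonneg (sq_nonneg (W.mesh n)) (sq_nonneg x)]
      _ ≤ _ := pow_le_pow_left₀ (by positivity) h3 2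

/-! ### Quantitative injectivity on connected sets. -/

theorem lt_abs_re_of_norm_sq_sub_one {q : ℂ} (hq : ‖q ^ 2 - 1‖ ≤ 56 / 100) :
    66 / 100 ≤ |q.re| := by
  have h1 := (abs_le.1 ((Complex.abs_re_le_norm _).trans hq)).1
  have h2 : (q ^ 2 - 1).re = q.re ^ 2 - q.im ^ 2 - 1 := by
    simp [sq]
  rw [h2] at h1
  refine le_of_sq_le_sq ?_ (abs_nonneg _)
  rw [sq_abs]
  nlinarith [sq_nonneg q.im]

theorem _root_.IsPreconnected.two_mul_le_abs_add {T : Set ℂ} (hT : IsPreconnected T) {f : ℂ → ℝ}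
    (hf : ContinuousOn f T) {c : ℝ} (hc : 0 < c) (h : ∀ w ∈ T, c ≤ |f w|) {x y : ℂ} (hx : x ∈ T)
    (hy : y ∈ T) : 2 * c ≤ |f x + f y| := by
  have key : ∀ x ∈ T, ∀ y ∈ T, f x ≤ 0 → 0 ≤ f y → False := by
    intro x hx y hy h1 h2
    obtain ⟨z, hz, e⟩ := hT.intermediate_value hx hy hf ⟨h1, h2⟩
    have := h z hz
    rw [e, abs_zero] at this
    linarith
  have hx' := h x hx
  have hy' := h y hy
  rcases le_total (f x) 0 with h1 | h1 <;> rcases le_total (f y) 0 with h2 | h2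
  · rw [abs_of_nonpos h1] at hx'
    rw [abs_of_nonpos h2] at hy'
    rw [abs_of_nonpos (by linarith)]
    linarith
  · exact (key x hx y hy h1 h2).elim
  · exact (key y hy x hx h2 h1).elim
  · rw [abs_of_nonneg h1] at hx'
    rw [abs_of_nonneg h2] at hy'
    rw [abs_of_nonneg (by linarith)]
    linarith

/-- With `c² = ε (z₀ - a)`, the quotient `(P_n - σ) / c` has square near 1, so its real part never
vanishes and keeps its sign on `T`. Two values thus cannot nearly cancel. -/
theorem mesh_le_norm_add_sub_centers (h : IsVerticalSlice γ z₀) {n : ℕ} {s : W.S n}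
    {σ : W.centers n} {T : Set ℂ} (hT : IsPreconnected T)
    (hTX : T ⊆ W.sliceX γ z₀ (n + 1) (s, σ)) {x y : ℂ} (hx : x ∈ T) (hy : y ∈ T) :
    33 / 100 * W.mesh n ≤
      ‖(W.sliceP γ z₀ n s x - σ) + (W.sliceP γ z₀ n s y - σ)‖ := by
  obtain ⟨c, hc⟩ := IsAlgClosed.exists_pow_nat_eq
    ((W.eps (n + 1) : ℂ) * (z₀ - W.a (n + 1))) (n := 2) (by norm_num)
  have hd := W.mesh_pos n
  have hcn := (W.norm_eps_mul_bounds h n).1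
  rw [← hc, norm_pow] at hcn
  have hc4 : W.mesh n / 4 ≤ ‖c‖ := by
    refine le_of_sq_le_sq ?_ (norm_nonneg _)
    linarith
  have hc0 : c ≠ 0 := norm_pos_iff.1 (by linarith)
  have hq : ∀ w ∈ T, 66 / 100 ≤ |((W.sliceP γ z₀ n s w - σ) / c).re| := by
    intro w hw
    refine lt_abs_re_of_norm_sq_sub_one ?_
    have hw' := (W.mem_sliceX_iff h).1 (hTX hw)
    have h3 := W.norm_eps_slope_mul_le h n hw'.1
    have h4 := hw'.2.le.trans (W.delta_succ_le n)
    have e : ((W.sliceP γ z₀ n s w - σ) / c) ^ 2 - 1 = (W.sliceP γ z₀ (n + 1) (s, σ) w +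
        (W.eps (n + 1) : ℂ) * (sliceSlope γ (n + 1) * w)) / c ^ 2 := by
      rw [div_pow, W.sq_sub_center, ← hc]
      field_simp
      ring
    -- The bound 56/100 is (1/40 + 1/100) divided by 1/16.
    rw [e, norm_div, norm_pow, div_le_iff₀ (by positivity)]
    have h5 := norm_add_le (W.sliceP γ z₀ (n + 1) (s, σ) w)
      ((W.eps (n + 1) : ℂ) * (sliceSlope γ (n + 1) * w))
    linarith
  have hcont : Continuous fun w => ((W.sliceP γ z₀ n s w - σ) / c).re :=
    Complex.continuous_re.comp (((W.continuous_sliceP γ z₀ n s).sub continuous_const).div_const c)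
  have h1 := hT.two_mul_le_abs_add hcont.continuousOn (by norm_num) hq hx hy
  rw [← Complex.add_re, ← add_div] at h1
  have h2 := h1.trans (Complex.abs_re_le_norm _)
  rw [norm_div, le_div_iff₀ (norm_pos_iff.2 hc0)] at h2
  linarith

/-- A difference of squares is the sum, bounded below by the branch argument, times the difference,
bounded by induction. Allowing any preconnected `T`, not only a component, lets the same set serve
at the previous rank. -/
theorem two_mul_delta_mul_norm_sub_le (h : IsVerticalSlice γ z₀) (n : ℕ) (s : W.S n) {T : Set ℂ}
    (hT : IsPreconnected T) (hTX : T ⊆ W.sliceX γ z₀ n s) {x y : ℂ} (hx : x ∈ T) (hy : y ∈ T) :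
    2 * W.delta n * ‖x - y‖ ≤ ‖W.sliceP γ z₀ n s x - W.sliceP γ z₀ n s y‖ := by
  induction n with
  | zero => simp [sliceP_zero, delta]
  | succ n ih =>
    obtain ⟨s, σ⟩ := s
    have h1 := ih s (hTX.trans (W.sliceX_succ_subset h n s σ))
    have h2 := W.mesh_le_norm_add_sub_centers h hT hTX hx hy
    have hd := W.mesh_pos n
    have h3 := W.norm_eps_slope_le h n
    have e : W.sliceP γ z₀ (n + 1) (s, σ) x - W.sliceP γ z₀ (n + 1) (s, σ) y =
        ((W.sliceP γ z₀ n s x - σ) + (W.sliceP γ z₀ n s y - σ)) *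
          (W.sliceP γ z₀ n s x - W.sliceP γ z₀ n s y) -
        (W.eps (n + 1) : ℂ) * sliceSlope γ (n + 1) * (x - y) := by
      rw [sliceP_succ, sliceP_succ]; ring
    rw [e]
    refine le_trans ?_ (norm_sub_norm_le _ _)
    rw [norm_mul, norm_mul _ (x - y)]
    have h4 := mul_le_mul h2 h1 (by have := W.delta_pos n; positivity) (norm_nonneg _)
    have h5 := mul_le_mul_of_nonneg_right h3 (norm_nonneg (x - y))
    have h6 := mul_le_mul_of_nonneg_right (W.delta_succ_le n) (norm_nonneg (x - y))
    have h7 := mul_le_mul_of_nonneg_right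
      (mul_le_mul_of_nonneg_left (W.mesh_le n) hd.le) (norm_nonneg (x - y))
    have h8 : 0 ≤ W.mesh n ^ 2 * ‖x - y‖ := by positivity
    nlinarith

theorem isOpen_sliceX (h : IsVerticalSlice γ z₀) (n : ℕ) (s : W.S n) :
    IsOpen (W.sliceX γ z₀ n s) := by
  have e : W.sliceX γ z₀ n s = {w | ‖w‖ < 1} ∩ {w | ‖W.sliceP γ z₀ n s w‖ < W.delta n} :=
    ext fun w => W.mem_sliceX_iff h
  rw [e]
  exact (isOpen_lt continuous_norm continuous_const).inter
    (isOpen_lt (W.continuous_sliceP γ z₀ n s).norm continuous_const)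

end Param

/-! ### Components and univalence. -/

theorem IsComponent.isPreconnected {Δ U : Set ℂ} (h : IsComponent Δ U) : IsPreconnected Δ := by
  obtain ⟨x, -, rfl⟩ := h
  exact isPreconnected_connectedComponentIn

theorem IsComponent.subset {Δ U : Set ℂ} (h : IsComponent Δ U) : Δ ⊆ U := by
  obtain ⟨x, -, rfl⟩ := h
  exact connectedComponentIn_subset U x

theorem IsComponent.nonempty {Δ U : Set ℂ} (h : IsComponent Δ U) : Δ.Nonempty := by
  obtain ⟨x, hx, rfl⟩ := h
  exact ⟨x, mem_connectedComponentIn hx⟩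

theorem IsComponent.isOpen {Δ U : Set ℂ} (h : IsComponent Δ U) (hU : IsOpen U) : IsOpen Δ := by
  obtain ⟨x, -, rfl⟩ := h
  exact hU.connectedComponentIn

/-- A set between a connected set and its closure is connected, so a component is relatively closed.
-/
theorem IsComponent.closure_inter_subset {Δ U : Set ℂ} (h : IsComponent Δ U) :
    closure Δ ∩ U ⊆ Δ := by
  have hp := h.isPreconnected
  have hs := h.subset
  obtain ⟨x, hx, rfl⟩ := h
  refine IsPreconnected.subset_connectedComponentIn ?_
    ⟨subset_closure (mem_connectedComponentIn hx), hx⟩ inter_subset_right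
  exact hp.subset_closure (subset_inter subset_closure hs) inter_subset_left

namespace Param

variable (W : Param) {γ z₀ : ℂ}

theorem injOn_sliceP (h : IsVerticalSlice γ z₀) {n : ℕ} {s : W.S n} {Δ : Set ℂ}
    (hΔ : IsComponent Δ (W.sliceX γ z₀ n s)) : InjOn (W.sliceP γ z₀ n s) Δ := by
  intro x hx y hy e
  have h1 := W.two_mul_delta_mul_norm_sub_le h n s hΔ.isPreconnected hΔ.subset hx hy
  rw [e, sub_self, norm_zero] at h1
  have h2 : ‖x - y‖ ≤ 0 := by
    by_contra! h3
    have := mul_pos (mul_pos two_pos (W.delta_pos n)) h3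
    linarith
  exact sub_eq_zero.1 (norm_le_zero_iff.1 h2)

theorem hasStrictDerivAt_sliceP (γ z₀ : ℂ) (n : ℕ) (s : W.S n) (w : ℂ) :
    HasStrictDerivAt (W.sliceP γ z₀ n s) (W.sliceD γ z₀ n s w) w :=
  hasStrictDerivAt_of_hasDerivAt_of_continuousAt
    (Eventually.of_forall fun w => W.hasDerivAt_sliceP γ z₀ n s w)
    (W.hasDerivAt_sliceD γ z₀ n s w).continuousAt

/-- The image is open because the derivative does not vanish. It is closed in the ball because limit
points of `Δ` have `‖w‖ ≤ 1/2`, so those with `‖P‖ < δ n` still lie in the trace, hence in `Δ`. -/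
theorem surjOn_sliceP (h : IsVerticalSlice γ z₀) {n : ℕ} {s : W.S n} {Δ : Set ℂ}
    (hΔ : IsComponent Δ (W.sliceX γ z₀ n s)) :
    SurjOn (W.sliceP γ z₀ n s) Δ (ball 0 (W.delta n)) := by
  have hopen : IsOpen (W.sliceP γ z₀ n s '' Δ) := by
    rw [isOpen_iff_mem_nhds]
    rintro _ ⟨w, hw, rfl⟩
    rw [← (W.hasStrictDerivAt_sliceP γ z₀ n s w).map_nhds_eq
      (W.sliceD_ne_zero h n s (hΔ.subset hw))]
    exact image_mem_map ((hΔ.isOpen (W.isOpen_sliceX h n s)).mem_nhds hw)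
  have hsub : closure Δ ⊆ closedBall 0 (1 / 2) :=
    closure_minimal (fun w hw => mem_closedBall_zero_iff.2
      (W.norm_lt_half_of_mem_sliceX h n s (hΔ.subset hw)).le) isClosed_closedBall
  have hcomp : IsCompact (closure Δ) :=
    (isCompact_closedBall (0 : ℂ) (1 / 2)).of_isClosed_subset isClosed_closure hsub
  have hclosed := (hcomp.image (W.continuous_sliceP γ z₀ n s)).isClosed
  have hball : IsPreconnected (ball (0 : ℂ) (W.delta n)) := (convex_ball _ _).isPreconnected
  refine hball.subset_of_closure_inter_subset hopen ?_ ?_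
  · obtain ⟨w, hw⟩ := hΔ.nonempty
    exact ⟨_, mem_ball_zero_iff.2 ((W.mem_sliceX_iff h).1 (hΔ.subset hw)).2,
      mem_image_of_mem _ hw⟩
  · rintro v ⟨hv, hvb⟩
    obtain ⟨w, hw, rfl⟩ := closure_minimal (image_mono subset_closure) hclosed hv
    refine mem_image_of_mem _ (hΔ.closure_inter_subset ⟨hw, (W.mem_sliceX_iff h).2 ⟨?_, ?_⟩⟩)
    · have := mem_closedBall_zero_iff.1 (hsub hw)
      linarith
    · exact mem_ball_zero_iff.1 hvb

theorem isUnivalentOnto_sliceP (h : IsVerticalSlice γ z₀) {n : ℕ} {s : W.S n} {Δ : Set ℂ}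
    (hΔ : IsComponent Δ (W.sliceX γ z₀ n s)) :
    IsUnivalentOnto (W.sliceP γ z₀ n s) Δ (ball 0 (W.delta n)) :=
  ⟨fun w _ => (W.hasDerivAt_sliceP γ z₀ n s w).differentiableAt.differentiableWithinAt,
    fun _ hw => mem_ball_zero_iff.2 ((W.mem_sliceX_iff h).1 (hΔ.subset hw)).2,
    W.injOn_sliceP h hΔ, W.surjOn_sliceP h hΔ⟩

end Param

/-! ### Distortion and comparison of constants. -/

theorem IsUnivalentOnto.norm_deriv_le_of_norm_deriv_deriv_le {P D E : ℂ → ℂ} {Δ : Set ℂ} {δ : ℝ}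
    (hΔ : IsOpen Δ) (hP : IsUnivalentOnto P Δ (ball 0 δ))
    (hD : ∀ w ∈ Δ, HasStrictDerivAt P (D w) w) (hE : ∀ w ∈ Δ, HasDerivAt D (E w) w)
    (h0 : ∀ w ∈ Δ, D w ≠ 0) (h : ∀ w ∈ Δ, δ * ‖E w‖ ≤ ‖D w‖ ^ 2) {x y : ℂ} (hx : x ∈ Δ)
    (hy : y ∈ Δ) : ‖D y‖ ≤ Real.exp 2 * ‖D x‖ := by
  obtain ⟨-, hmaps, hinj, hsurj⟩ := hP
  set g := Function.invFunOn P Δ with hg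
  have hgm : ∀ v ∈ ball (0 : ℂ) δ, g v ∈ Δ := fun v hv => Function.invFunOn_mem (hsurj hv)
  have hgl : ∀ w ∈ Δ, g (P w) = w := fun w hw => hinj.leftInvOn_invFunOn hw
  have hgd : ∀ v ∈ ball (0 : ℂ) δ, HasDerivAt g (D (g v))⁻¹ v := by
    intro v hv
    have hw := hgm v hv
    have h1 := (hD _ hw).to_local_left_inverse (h0 _ hw) (g := g)
      (by filter_upwards [hΔ.mem_nhds hw] with z hz using hgl z hz)
    have e : P (g v) = v := Function.invFunOn_eq (hsurj hv)
    rw [e] at h1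
    exact h1.hasDerivAt
  set v := P x
  set u := P y
  have hseg : ∀ t ∈ Icc (0 : ℝ) 1, v + t * (u - v) ∈ ball (0 : ℂ) δ := by
    intro t ht
    have := (convex_ball (0 : ℂ) δ).add_smul_sub_mem (hmaps hx) (hmaps hy) ht
    simpa using this
  have hline : ∀ t : ℝ, HasDerivAt (fun t : ℝ => v + (t : ℂ) * (u - v)) (u - v) t := by
    intro t
    have := ((Complex.ofRealCLM.hasDerivAt (x := t)).mul_const (u - v)).const_add v
    simpa using this
  have hder : ∀ t ∈ Icc (0 : ℝ) 1, HasDerivAt (fun t : ℝ => D (g (v + t * (u - v))))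
      (E (g (v + t * (u - v))) * ((D (g (v + t * (u - v))))⁻¹ * (u - v))) t := by
    intro t ht
    have hv := hseg t ht
    have h1 : HasDerivAt (fun t : ℝ => g (v + t * (u - v))) _ t :=
      HasDerivAt.comp_of_eq t (hgd _ hv) (hline t) rfl
    exact HasDerivAt.comp_of_eq t (hE _ (hgm _ hv)) h1 rfl
  have huv : ‖u - v‖ ≤ 2 * δ := by
    have h1 := mem_ball_zero_iff.1 (hmaps hx)
    have h2 := mem_ball_zero_iff.1 (hmaps hy)
    have := norm_sub_le u v
    linarith
  -- Grönwall for `D ∘ g` on the segment from `P x` to `P y`: the rate is 2 since the segment has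
  -- length at most `2 δ` and `(D ∘ g)' = E / D`.
  have key := norm_le_gronwallBound_of_norm_deriv_right_le (K := 2) (ε := 0) (δ := ‖D x‖)
    (a := 0) (b := 1) (fun t ht => (hder t ht).continuousAt.continuousWithinAt)
    (fun t ht => (hder t ⟨ht.1, ht.2.le⟩).hasDerivWithinAt)
    (by simp [v, hgl x hx])
    (by
      intro t ht
      have hw := hgm _ (hseg t ⟨ht.1, ht.2.le⟩)
      set w := g (v + t * (u - v))
      have h1 : 0 < ‖D w‖ := norm_pos_iff.2 (h0 w hw)
      have h2 := h w hw
      rw [norm_mul, norm_mul, norm_inv, add_zero]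
      calc ‖E w‖ * (‖D w‖⁻¹ * ‖u - v‖) ≤ ‖E w‖ * (‖D w‖⁻¹ * (2 * δ)) := by gcongr
        _ = 2 * (δ * ‖E w‖) * ‖D w‖⁻¹ := by ring
        _ ≤ 2 * ‖D w‖ ^ 2 * ‖D w‖⁻¹ := by gcongr
        _ = 2 * ‖D w‖ := by field_simp)
    1 (by simp)
  rw [gronwallBound_ε0] at key
  simp only [Complex.ofReal_one, one_mul, add_sub_cancel, sub_zero, mul_one] at key
  rw [hgl y hy, mul_comm] at key
  exact key

theorem distortion_le_ofReal {f : ℂ → ℂ} {U : Set ℂ} {K : ℝ} (hK : 0 ≤ K)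
    (h : ∀ z ∈ U, ∀ w ∈ U, ‖deriv f z‖ ≤ K * ‖deriv f w‖) :
    distortion f U ≤ ENNReal.ofReal K := by
  refine iSup₂_le fun z hz => iSup₂_le fun w hw => ?_
  refine ENNReal.div_le_of_le_mul ?_
  rw [← ofReal_norm, ← ofReal_norm, ← ENNReal.ofReal_mul hK]
  exact ENNReal.ofReal_le_ofReal (h z hz w hw)

theorem IsUnivalentOnto.const_mul {f : ℂ → ℂ} {U : Set ℂ} {δ : ℝ}
    (hf : IsUnivalentOnto f U (ball 0 δ)) {c : ℂ} (hc : c ≠ 0) :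
    IsUnivalentOnto (fun w => c * f w) U (ball 0 (‖c‖ * δ)) := by
  refine ⟨hf.1.const_mul c, fun w hw => ?_, fun x hx y hy e => ?_, fun v hv => ?_⟩
  · rw [mem_ball_zero_iff, norm_mul]
    exact mul_lt_mul_of_pos_left (mem_ball_zero_iff.1 (hf.2.1 hw)) (norm_pos_iff.2 hc)
  · exact hf.2.2.1 hx hy (mul_left_cancel₀ hc e)
  · have hv' : c⁻¹ * v ∈ ball (0 : ℂ) δ := by
      rw [mem_ball_zero_iff, norm_mul, norm_inv, inv_mul_lt_iff₀ (norm_pos_iff.2 hc)]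
      exact mem_ball_zero_iff.1 hv
    obtain ⟨w, hw, e⟩ := hf.2.2.2 hv'
    refine ⟨w, hw, ?_⟩
    simp only [e]
    exact mul_inv_cancel_left₀ hc v

/-- The factor 2 is needed at rank 0, where `δ M / R = 1/2` but the derivative is 1; for `n ≥ 1` it
is absorbed in `2 ^ n`. -/
theorem approx_of_le {n : ℕ} {x y : ℝ} (hx : 0 ≤ x) (h1 : x ≤ y) (h2 : y ≤ 2 * 6 ^ n * x) :
    Approx 12 n x y := by
  have hC : (2 * 6 ^ n : ℝ) ≤ 12 ^ max n 1 := by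
    rcases Nat.eq_zero_or_pos n with rfl | hn
    · norm_num
    · rw [max_eq_left hn]
      calc (2 * 6 ^ n : ℝ) ≤ 2 ^ n * 6 ^ n := by
            gcongr
            exact le_self_pow₀ (by norm_num) hn.ne'
        _ = 12 ^ n := by rw [← mul_pow]; norm_num
  exact ⟨(div_le_self hx (one_le_pow₀ (by norm_num))).trans h1,
    h2.trans (mul_le_mul_of_nonneg_right hC hx)⟩

theorem Approx.const_div {C : ℝ} (hC : 0 < C) {n : ℕ} {x y d : ℝ} (hx : 0 < x) (hy : 0 < y)
    (hd : 0 < d) (h : Approx C n x y) : Approx C n (d / x) (d / y) := by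
  obtain ⟨h1, h2⟩ := h
  have hk : 0 < C ^ max n 1 := pow_pos hC _
  constructor
  · rw [div_div, mul_comm]
    exact div_le_div_of_nonneg_left hd.le hy h2
  · calc d / y ≤ d / (x / C ^ max n 1) := div_le_div_of_nonneg_left hd.le (by positivity) h1
      _ = C ^ max n 1 * (d / x) := by field_simp

end Wermer

/-! ### Assembly. -/

theorem mainTheorem8 :
    ∃ K C : ℝ, 0 < K ∧ 0 < C ∧
      ∀ (W : Wermer.Param) (γ z₀ : ℂ), Wermer.IsVerticalSlice γ z₀ →
      ∀ (n : ℕ) (s : W.S n) (Δ : Set ℂ), Wermer.IsComponent Δ (W.sliceX γ z₀ n s) →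
        (∃ p ∈ Δ, ∃ ρ : ℝ,
          W.sliceP γ z₀ n s p = 0 ∧
          Wermer.HasConformalRadius Δ p ρ ∧
          Wermer.Approx C n (W.R n / W.M n) ρ ∧
          ∃ f : ℂ → ℂ, Wermer.IsUnivalentOnto f Δ (Metric.ball 0 ρ) ∧ f p = 0 ∧
            ‖deriv f p‖ = 1 ∧ Wermer.distortion f Δ ≤ ENNReal.ofReal K) ∧
        Wermer.IsUnivalentOnto (W.sliceP γ z₀ n s) Δ (Metric.ball 0 (W.delta n)) ∧
        Wermer.distortion (W.sliceP γ z₀ n s) Δ ≤ ENNReal.ofReal K ∧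
        ∀ w ∈ Δ, Wermer.Approx C n (W.delta n * W.M n / W.R n) ‖deriv (W.sliceP γ z₀ n s) w‖ := by
  refine ⟨Real.exp 2, 12, Real.exp_pos 2, by norm_num, ?_⟩
  intro W γ z₀ h n s Δ hΔ
  have hδ := W.delta_pos n
  have hR := W.R_pos n
  have hM := W.M_pos n
  have hU := W.isUnivalentOnto_sliceP h hΔ
  have hder : ∀ w, deriv (W.sliceP γ z₀ n s) w = W.sliceD γ z₀ n s w :=
    fun w => (W.hasDerivAt_sliceP γ z₀ n s w).deriv
  have h0 : ∀ w ∈ Δ, W.sliceD γ z₀ n s w ≠ 0 :=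
    fun w hw => W.sliceD_ne_zero h n s (hΔ.subset hw)
  have hdist : ∀ z ∈ Δ, ∀ w ∈ Δ,
      ‖W.sliceD γ z₀ n s z‖ ≤ Real.exp 2 * ‖W.sliceD γ z₀ n s w‖ := fun z hz w hw =>
    hU.norm_deriv_le_of_norm_deriv_deriv_le (hΔ.isOpen (W.isOpen_sliceX h n s))
      (fun w _ => W.hasStrictDerivAt_sliceP γ z₀ n s w)
      (fun w _ => W.hasDerivAt_sliceD γ z₀ n s w) h0
      (fun w hw => W.delta_mul_norm_sliceDD_le h n s (hΔ.subset hw)) hw hz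
  have happ : ∀ w ∈ Δ, Wermer.Approx 12 n (W.delta n * W.M n / W.R n)
      ‖W.sliceD γ z₀ n s w‖ := fun w hw => by
    obtain ⟨h1, h2⟩ := W.norm_sliceD_bounds h n s (hΔ.subset hw)
    exact Wermer.approx_of_le (by positivity) h1 h2
  refine ⟨?_, hU, ?_, fun w hw => by rw [hder]; exact happ w hw⟩
  · obtain ⟨p, hp, hp0⟩ := hU.2.2.2 (mem_ball_self hδ)
    have hDp : 0 < ‖W.sliceD γ z₀ n s p‖ := norm_pos_iff.2 (h0 p hp)
    have hcd : ∀ (c w : ℂ), deriv (fun w => c * W.sliceP γ z₀ n s w) w =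
        c * W.sliceD γ z₀ n s w := fun c w =>
      ((W.hasDerivAt_sliceP γ z₀ n s w).const_mul c).deriv
    -- Dividing `P` by `δ n` gives the map onto the unit disk, so `ρ = δ n / ‖P'(p)‖`; dividing it
    -- by `P'(p)` gives the normalized map onto `D(0, ρ)`, with the same distortion.
    refine ⟨p, hp, W.delta n / ‖W.sliceD γ z₀ n s p‖, hp0, ⟨by positivity, hp,
      fun w => (W.delta n : ℂ)⁻¹ * W.sliceP γ z₀ n s w, ?_, by simp [hp0], ?_⟩, ?_,
      fun w => (W.sliceD γ z₀ n s p)⁻¹ * W.sliceP γ z₀ n s w, ?_, by simp [hp0], ?_, ?_⟩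
    · have := hU.const_mul (c := (W.delta n : ℂ)⁻¹)
        (inv_ne_zero (Complex.ofReal_ne_zero.2 hδ.ne'))
      rwa [norm_inv, Complex.norm_real, Real.norm_of_nonneg hδ.le,
        inv_mul_cancel₀ hδ.ne'] at this
    · rw [hcd, norm_mul, norm_inv, Complex.norm_real, Real.norm_of_nonneg hδ.le, one_div_div]
      ring
    · have := (happ p hp).const_div (by norm_num) (by positivity) hDp hδ
      convert this using 1
      field_simp
    · have := hU.const_mul (inv_ne_zero (h0 p hp))
      rwa [norm_inv, inv_mul_eq_div] at this
    · rw [hcd, inv_mul_cancel₀ (h0 p hp), norm_one]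
    · refine Wermer.distortion_le_ofReal (Real.exp_pos 2).le fun z hz w hw => ?_
      rw [hcd, hcd, norm_mul, norm_mul, mul_left_comm]
      exact mul_le_mul_of_nonneg_left (hdist z hz w hw) (norm_nonneg _)
  · refine Wermer.distortion_le_ofReal (Real.exp_pos 2).le fun z hz w hw => ?_
    rw [hder, hder]
    exact hdist z hz w hw
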